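/- Let $E$ be a $d$-dimensional Euclidean space (for instance $\mathbb{R}^d$, or the row space of a $d\times n$ generator matrix of rank $d$), with Lebesgue measure $\mathrm{vol}$. For vectors $G=(g_1,\dots,g_d)$ in $E$ let $\Lambda(G)=\{\sum_i k_i g_i : k_i\in\mathbb{Z}\}$ and let $\Omega(G)=\{x\in E : \|x\|\le\|x-\lambda\| \text{ for all } \lambda\in\Lambda(G)\}$ be the Voronoi cell of $\Lambda(G)$. Let $B$ be a basis of $E$, and let $A=(a_1,\dots,a_d)$ generate the dual lattice of $\Lambda(B)$ scaled by $2\pi$, that is, $\Lambda(A)=\{x\in E : \langle x,y\rangle\in 2\pi\mathbb{Z} \text{ for all } y\in\Lambda(B)\}$. Let $\omega_0>0$, $S_0\ge 0$, $\Delta=\{\omega\in E:\|\omega\|\le\omega_0\}$, and let $(X(t))_{t\in E}$ be a real or complex wide-sense stationary process (finite second moments, constant mean, autocorrelation depending only on the time difference) whose power spectral density is $S(\omega)=S_0$ for $\omega\in\Delta$ and $S(\omega)=0$ for $\omega\notin\Delta$, that is, $$\mathbb{E}\bigl[X(t+\tau)\overline{X(t)}\bigr]=\frac{1}{(2\pi)^d}\int_E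 S(\omega)\,e^{i\langle\omega,\tau\rangle}\,d\omega\qquad\text{for all } t,\tau\in E .$$ Put $\sigma^2=(2\pi)^{-d}\int_E S(\omega)\,d\omega$. For $t\in E$ let $\hat X(t)$ be the best linear interpolator of $X(t)$ from the samples on $\Lambda(B)$, i.e. the orthogonal projection in $L^2$ of $X(t)$ onto the closed linear span of $\{X(\lambda):\lambda\in\Lambda(B)\}$. Then $t\mapsto\mathbb{E}|X(t)-\hat X(t)|^2$ is integrable on $\Omega(B)$, and the average reconstruction error variance is $$\sigma_{\mathrm e}^2:=\frac{1}{\mathrm{vol}\,\Omega(B)}\int_{\Omega(B)}\mathbb{E}\bigl|X(t)-\hat X(t)\bigr|^2\,dt=\sigma^2\,\frac{\mathrm{vol}(\Delta\setminus\Omega(A))}{\mathrm{vol}\,\Delta}.$$ -/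

import Mathlib

open MeasureTheory
open scoped InnerProductSpace

noncomputable section

namespace LatticeSampling

section Lattices

variable {E : Type*} [NormedAddCommGroup E] [InnerProductSpace ℝ E]

/-- The lattice `Λ(G)`: all integer combinations of the generators `G 0, …, G (d - 1)`
(the rows of a generator matrix). -/
def lattice {d : ℕ} (G : Fin d → E) : Submodule ℤ E :=
  Submodule.span ℤ (Set.range G)

/-- The dual lattice scaled by `2π`: all `x` whose inner product with every lattice vector
is an integer multiple of `2π`. -/
def scaledDual (L : Submodule ℤ E) : Set E :=
  {x | ∀ y ∈ L, ∃ k : ℤ, ⟪x, y⟫_ℝ = 2 * Real.pi * k}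

/-- The (closed) Voronoi cell of the origin: all points that are at least as close to `0`
as to any other lattice point. -/
def voronoiCell (L : Submodule ℤ E) : Set E :=
  {x | ∀ y ∈ L, ‖x‖ ≤ ‖x - y‖}

end Lattices

section Processes

variable {E : Type*} [NormedAddCommGroup E] [InnerProductSpace ℝ E]
variable {Ω : Type*} [MeasurableSpace Ω]
variable {𝕜 : Type*} [RCLike 𝕜]

/-- The autocorrelation `𝔼[X(s) conj X(t)]`. -/
def autocorr (P : Measure Ω) (X : E → Ω → 𝕜) (s t : E) : 𝕜 :=
  ∫ w, X s w * starRingEnd 𝕜 (X t w) ∂P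

/-- A (wide-sense) stationary process: finite second moments, constant mean, and
autocorrelation that depends on the time difference only. -/
structure IsStationary (P : Measure Ω) (X : E → Ω → 𝕜) : Prop where
  memLp : ∀ t, MemLp (X t) 2 P
  mean_eq : ∀ s t, ∫ w, X s w ∂P = ∫ w, X t w ∂P
  autocorr_eq : ∀ τ t, autocorr P X (t + τ) t = autocorr P X τ 0

/-- `S` is the power spectral density of the process `X` on a `d`-dimensional space, as a
function of the angular frequency: `S` is nonnegative and integrable, and the autocorrelation at
lag `τ` is `(2π)⁻ᵈ ∫ S(ω) exp(i⟨ω, τ⟩) dω`. Both sides are compared in `ℂ`, so that real and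
complex processes are covered. -/
structure HasSpectralDensity [FiniteDimensional ℝ E] [MeasurableSpace E] [BorelSpace E]
    (P : Measure Ω) (X : E → Ω → 𝕜) (S : E → ℝ) : Prop where
  nonneg : ∀ ω, 0 ≤ S ω
  integrable : Integrable S
  autocorr_eq : ∀ τ t, RCLike.map 𝕜 ℂ (autocorr P X (t + τ) t) =
    ((2 * (Real.pi : ℂ)) ^ Module.finrank ℝ E)⁻¹ *
      ∫ ω, (S ω : ℂ) * Complex.exp (Complex.I * (⟪ω, τ⟫_ℝ : ℂ))

/-- The process variance `σ² = (2π)⁻ᵈ ∫ S(ω) dω`. -/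
def processVariance [FiniteDimensional ℝ E] [MeasurableSpace E] [BorelSpace E]
    (S : E → ℝ) : ℝ :=
  ((2 * Real.pi) ^ Module.finrank ℝ E)⁻¹ * ∫ ω, S ω

/-- The closed linear span, in `L²(P)`, of the samples `X(λ)`, `λ ∈ L`: the space of all
linear interpolators. -/
def sampleSpan {P : Measure Ω} {X : E → Ω → 𝕜} (hX : IsStationary P X) (L : Submodule ℤ E) :
    Submodule 𝕜 (Lp 𝕜 2 P) :=
  (Submodule.span 𝕜 ((fun t => (hX.memLp t).toLp (X t)) '' (L : Set E))).topologicalClosure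

/-- The best linear interpolator of `X(t)` from the samples `X(λ)`, `λ ∈ L`: the element of
their closed linear span that is nearest to `X(t)` in mean square, i.e. the orthogonal
projection of `X(t)`. -/
def bestLinearInterpolator {P : Measure Ω} {X : E → Ω → 𝕜} (hX : IsStationary P X)
    (L : Submodule ℤ E) (t : E) : Lp 𝕜 2 P :=
  haveI : CompleteSpace (sampleSpan hX L) :=
    (Submodule.isClosed_topologicalClosure _).completeSpace_coe
  (sampleSpan hX L).starProjection ((hX.memLp t).toLp (X t))

/-- The reconstruction error variance at time `t`: the mean-square difference between `X(t)`
and its best linear interpolator. -/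
def errorVarianceAt {P : Measure Ω} {X : E → Ω → 𝕜} (hX : IsStationary P X)
    (L : Submodule ℤ E) (t : E) : ℝ :=
  ∫ w, ‖X t w - bestLinearInterpolator hX L t w‖ ^ 2 ∂P

/-- The average reconstruction error variance: the mean of the (lattice-periodic) error
variance over the Voronoi cell of the sampling lattice. -/
def averageErrorVariance [FiniteDimensional ℝ E] [MeasurableSpace E] [BorelSpace E]
    {P : Measure Ω} {X : E → Ω → 𝕜} (hX : IsStationary P X) (L : Submodule ℤ E) : ℝ :=
  ⨍ t in voronoiCell L, errorVarianceAt hX L t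

end Processes

/-- The isotropically bandlimited spectrum: `S₀` on the ball `Δ` of radius `ω₀` about `0`,
and `0` outside. -/
def flatSpectrum {E : Type*} [NormedAddCommGroup E] (S₀ ω₀ : ℝ) : E → ℝ :=
  (Metric.closedBall (0 : E) ω₀).indicator fun _ => S₀

end LatticeSampling

end

noncomputable section

namespace LatticeSampling

/-! ### Dual lattices and Voronoi cells -/

section Geometry

/-! Up to a spectral isometry, `X t` is the character `ω ↦ exp (i⟨ω, t⟩)` in L²(μ), where μ is a
constant c times Lebesgue measure on the ball Δ: both families have the same Gram matrix
(`map_inner_toLp_eq_integral_character`), so they have the same distances to the sample spans, even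
when the process is real (`norm_sub_starProjection_eq_of_gram`).

The characters indexed by Λ(B) are exactly Λ(A)-periodic, and their closed span contains every
periodic L² function (`toLp_mem_closure_span_characterLp`). Hence the projection of a character is
its average over those points of each Λ(A)-coset that lie in Δ. With D a fundamental parallelepiped
of Λ(A), N(u) the number of points of u + Λ(A) in Δ and s_t(u) the sum of the character over them,
Pythagoras gives the error c(vol Δ - ∫_D |s_t(u)|² / N(u) du)
(`norm_sq_sub_starProjection_characterLp`).

Averaging over t in Ω(B), the cross terms exp(i⟨k - l, t⟩) vanish, so |s_t(u)|² has mean N(u) and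
the quotient becomes the indicator of N(u) > 0 (`setIntegral_setIntegral_foldSum_ratio`). What
remains is the volume of D covered by translates of Δ. This set is periodic, so D may be replaced by
Ω(A); there a point is shortest in its coset, so the covered part is Δ ∩ Ω(A)
(`volume_covered_inter_fundamentalDomain`). -/

theorem isClosed_voronoiCell {E : Type*} [NormedAddCommGroup E] (L : Submodule ℤ E) :
    IsClosed (voronoiCell L) := by
  have : voronoiCell L = ⋂ y ∈ L, {x : E | ‖x‖ ≤ ‖x - y‖} := by
    ext x; simp [voronoiCell]
  rw [this]
  exact isClosed_biInter fun y _ => isClosed_le continuous_norm (by fun_prop)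

variable {E : Type*} [NormedAddCommGroup E] [InnerProductSpace ℝ E] {d : ℕ}

/-- The pairing scaled by (2π)⁻¹ is nondegenerate, so `b` has a dual basis for it. This identity is
the only link between the two lattices used below. -/
theorem exists_dual_basis (b : Module.Basis (Fin d) ℝ E) :
    ∃ a : Module.Basis (Fin d) ℝ E, ∀ x i, ⟪x, b i⟫_ℝ = 2 * Real.pi * a.repr x i := by
  have hn : ((2 * Real.pi)⁻¹ • (innerₗ E : LinearMap.BilinForm ℝ E)).Nondegenerate := by
    constructor
    · intro x hx
      have := hx x
      simpa [Real.pi_ne_zero] using this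
    · intro x hx
      have := hx x
      simpa [Real.pi_ne_zero] using this
  refine ⟨LinearMap.BilinForm.dualBasis _ hn b, fun x i => ?_⟩
  rw [LinearMap.BilinForm.dualBasis_repr_apply]
  simp only [LinearMap.smul_apply, innerₗ_apply_apply, smul_eq_mul]
  field_simp

theorem scaledDual_span {a b : Module.Basis (Fin d) ℝ E}
    (hab : ∀ x i, ⟪x, b i⟫_ℝ = 2 * Real.pi * a.repr x i) :
    scaledDual (Submodule.span ℤ (Set.range b)) = (Submodule.span ℤ (Set.range a) : Set E) := by
  ext x
  rw [SetLike.mem_coe, Module.Basis.mem_span_iff_repr_mem]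
  constructor
  · intro h i
    obtain ⟨k, hk⟩ := h (b i) (Submodule.subset_span ⟨i, rfl⟩)
    rw [hab] at hk
    exact ⟨k, by simpa [Real.pi_ne_zero] using hk.symm⟩
  · intro h y hy
    induction hy using Submodule.span_induction with
    | mem y hy =>
      obtain ⟨i, rfl⟩ := hy
      obtain ⟨k, hk⟩ := h i
      exact ⟨k, by rw [hab, ← hk]; simp⟩
    | zero => exact ⟨0, by simp⟩
    | add y z _ _ hy hz =>
      obtain ⟨k, hk⟩ := hy
      obtain ⟨l, hl⟩ := hz
      exact ⟨k + l, by rw [inner_add_right, hk, hl]; push_cast; ring⟩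
    | smul m y _ hy =>
      obtain ⟨k, hk⟩ := hy
      exact ⟨m * k, by
        rw [← Int.cast_smul_eq_zsmul ℝ, real_inner_smul_right, hk]; push_cast; ring⟩

variable [FiniteDimensional ℝ E] [MeasurableSpace E] [BorelSpace E]

theorem volume_equidistant {v : E} (hv : v ≠ 0) : volume {x : E | ‖x‖ = ‖x - v‖} = 0 := by
  have h := Measure.addHaar_affineSubspace (volume : Measure E)
    (AffineSubspace.perpBisector (0 : E) v) (by
      rw [Ne, AffineSubspace.perpBisector_eq_top]
      exact hv.symm)
  convert h using 2
  ext x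
  simp [AffineSubspace.mem_perpBisector_iff_dist_eq, dist_eq_norm]

instance vaddInvariantMeasure_submodule (L : Submodule ℤ E) :
    VAddInvariantMeasure L E (volume : Measure E) :=
  inferInstanceAs (VAddInvariantMeasure L.toAddSubgroup E (volume : Measure E))

/-- Translates cover because the lattice is closed, so each point has a nearest lattice point; two
of them overlap only inside a bisecting hyperplane, which is null. -/
theorem isAddFundamentalDomain_voronoiCell (b : Module.Basis (Fin d) ℝ E) :
    IsAddFundamentalDomain (Submodule.span ℤ (Set.range b))
      (voronoiCell (Submodule.span ℤ (Set.range b))) (volume : Measure E) := by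
  refine IsAddFundamentalDomain.mk'' (isClosed_voronoiCell _).measurableSet.nullMeasurableSet
    (Filter.Eventually.of_forall fun x => ?_) (fun g hg => ?_)
    (fun g => (measurePreserving_vadd g volume).quasiMeasurePreserving)
  · have hc : IsClosed ((Submodule.span ℤ (Set.range b) : Set E)) := by
      rw [← Submodule.coe_toAddSubgroup]
      exact AddSubgroup.isClosed_of_discrete
    obtain ⟨y, hy, hxy⟩ := hc.exists_infDist_eq_dist ⟨0, zero_mem _⟩ x
    refine ⟨-⟨y, hy⟩, fun z hz => ?_⟩
    have h := Metric.infDist_le_dist_of_mem (x := x) (add_mem hy hz)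
    rw [hxy, dist_eq_norm, dist_eq_norm] at h
    rw [Submodule.vadd_def, vadd_eq_add]
    simp only [NegMemClass.coe_neg]
    rwa [neg_add_eq_sub, sub_sub]
  · refine measure_mono_null ?_ (volume_equidistant (v := (g : E)) (by simpa using hg))
    rintro x ⟨⟨y, hy, rfl⟩, hx⟩
    refine le_antisymm (hx g g.2) ?_
    have h := hy (-g) (neg_mem g.2)
    simp only [Submodule.vadd_def, vadd_eq_add, sub_neg_eq_add, add_sub_cancel_left] at h ⊢
    rwa [add_comm]

theorem volume_voronoiCell_ne_top (b : Module.Basis (Fin d) ℝ E) :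
    volume (voronoiCell (Submodule.span ℤ (Set.range b))) ≠ ⊤ := by
  rw [(isAddFundamentalDomain_voronoiCell b).measure_eq (ZSpan.isAddFundamentalDomain b volume)]
  exact (ZSpan.fundamentalDomain_isBounded b).measure_lt_top.ne

theorem volume_voronoiCell_ne_zero (b : Module.Basis (Fin d) ℝ E) :
    volume (voronoiCell (Submodule.span ℤ (Set.range b))) ≠ 0 := by
  rw [(isAddFundamentalDomain_voronoiCell b).measure_eq (ZSpan.isAddFundamentalDomain b volume)]
  exact ZSpan.measure_fundamentalDomain_ne_zero b

/-- The part of the Voronoi cell covered by lattice translates of a ball about the origin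
is the part covered by the ball itself. -/
theorem volume_covered_inter_fundamentalDomain (a : Module.Basis (Fin d) ℝ E) (r : ℝ) :
    volume ({x : E | ∃ k : Submodule.span ℤ (Set.range a), k +ᵥ x ∈ Metric.closedBall (0 : E) r} ∩
        ZSpan.fundamentalDomain a) =
      volume (Metric.closedBall (0 : E) r ∩ voronoiCell (Submodule.span ℤ (Set.range a))) := by
  rw [(ZSpan.isAddFundamentalDomain a volume).measure_set_eq
    (isAddFundamentalDomain_voronoiCell a)]
  · congr 1
    ext x
    simp only [Set.mem_inter_iff, Set.mem_ofPred_eq, mem_closedBall_zero_iff,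
      and_congr_left_iff, Submodule.vadd_def, vadd_eq_add]
    intro hx
    refine ⟨fun ⟨k, hk⟩ => ?_, fun h => ⟨0, by simpa using h⟩⟩
    -- The Voronoi inequality at -k gives ‖x‖ ≤ ‖k + x‖, so x is in the ball as soon as one
    -- translate is.
    have := hx (-k) (neg_mem k.2)
    rw [sub_neg_eq_add, add_comm] at this
    exact this.trans hk
  · rw [Set.ofPred_exists]
    exact MeasurableSet.iUnion fun k =>
      Metric.isClosed_closedBall.measurableSet.preimage (measurable_const_vadd k)
  · intro g
    ext x
    simp only [Set.mem_preimage, Set.mem_ofPred_eq]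
    constructor
    · rintro ⟨k, hk⟩
      exact ⟨k + g, by rwa [add_vadd]⟩
    · rintro ⟨k, hk⟩
      exact ⟨k - g, by rwa [vadd_vadd, sub_add_cancel]⟩

end Geometry

/-! ### Distances to a closed span depend only on the Gram matrix -/

section Hilbert

open Submodule

/-- The projection realizes the distance to the closed span, and the coefficientwise bound passes to
the closure. The two scalar fields may differ, so that this serves in both directions. -/
theorem norm_sub_starProjection_le_of_coeff
    {𝕜 𝕜' ι H H' : Type*} [RCLike 𝕜] [RCLike 𝕜']
    [NormedAddCommGroup H] [InnerProductSpace 𝕜 H]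
    [NormedAddCommGroup H'] [InnerProductSpace 𝕜' H'] (T : Set ι) (x : ι → H) (y : ι → H')
    (t : ι)
    [CompleteSpace (span 𝕜 (x '' T)).topologicalClosure]
    [CompleteSpace (span 𝕜' (y '' T)).topologicalClosure]
    (h : ∀ c' : ι →₀ 𝕜', (c'.support : Set ι) ⊆ T → ∃ c : ι →₀ 𝕜, (c.support : Set ι) ⊆ T ∧
      ‖x t - c.sum fun i a => a • x i‖ ≤ ‖y t - c'.sum fun i a => a • y i‖) :
    ‖x t - (span 𝕜 (x '' T)).topologicalClosure.starProjection (x t)‖ ≤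
      ‖y t - (span 𝕜' (y '' T)).topologicalClosure.starProjection (y t)‖ := by
  set K := (span 𝕜 (x '' T)).topologicalClosure
  have key : ∀ z ∈ (span 𝕜' (y '' T)).topologicalClosure,
      ‖x t - K.starProjection (x t)‖ ≤ ‖y t - z‖ := by
    intro z hz
    have hc : IsClosed {z | ‖x t - K.starProjection (x t)‖ ≤ ‖y t - z‖} :=
      isClosed_le continuous_const (by fun_prop)
    refine closure_minimal (fun z hz => ?_) hc hz
    obtain ⟨c', hc', rfl⟩ := (Finsupp.mem_span_image_iff_linearCombination 𝕜').1 hz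
    obtain ⟨c, hcT, hle⟩ := h c' hc'
    refine le_trans ?_ hle
    rw [starProjection_minimal]
    refine ciInf_le_of_le ⟨0, by rintro _ ⟨_, rfl⟩; positivity⟩
      ⟨_, le_topologicalClosure _ ((Finsupp.mem_span_image_iff_linearCombination 𝕜).2
        ⟨c, hcT, rfl⟩)⟩ le_rfl
  exact key _ (starProjection_apply_mem _ _)

section RCLikeMap

variable {𝕜 : Type*} [RCLike 𝕜]

theorem rclike_map_mul (x y : 𝕜) :
    RCLike.map 𝕜 ℂ (x * y) = RCLike.map 𝕜 ℂ x * RCLike.map 𝕜 ℂ y := by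
  apply Complex.ext <;> simp [RCLike.mul_re, RCLike.mul_im]

theorem rclike_map_conj (x : 𝕜) :
    RCLike.map 𝕜 ℂ (starRingEnd 𝕜 x) = starRingEnd ℂ (RCLike.map 𝕜 ℂ x) := by
  apply Complex.ext <;> simp

end RCLikeMap

section Gram

variable {𝕜 ι H H' : Type*} [RCLike 𝕜]
  [NormedAddCommGroup H] [InnerProductSpace 𝕜 H]
  [NormedAddCommGroup H'] [InnerProductSpace ℂ H'] {x : ι → H} {y : ι → H'}

theorem norm_linearCombination_of_gram
    (hG : ∀ s t, RCLike.map 𝕜 ℂ ⟪x s, x t⟫_𝕜 = ⟪y s, y t⟫_ℂ) (c : ι →₀ 𝕜) :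
    ‖Finsupp.linearCombination ℂ y
        (Finsupp.mapRange.addMonoidHom (RCLike.map 𝕜 ℂ : 𝕜 →+ ℂ) c)‖ =
      ‖Finsupp.linearCombination 𝕜 x c‖ := by
  rw [← sq_eq_sq₀ (norm_nonneg _) (norm_nonneg _), ← @inner_self_eq_norm_sq ℂ,
    ← @inner_self_eq_norm_sq 𝕜]
  have h1 : ∀ z : 𝕜, RCLike.re z = RCLike.re (RCLike.map 𝕜 ℂ z) := fun z => by simp
  rw [h1]
  congr 1
  simp only [Finsupp.linearCombination_apply]
  rw [Finsupp.mapRange.addMonoidHom_apply, Finsupp.sum_mapRange_index (by simp)]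
  simp only [Finsupp.sum, sum_inner, inner_sum, inner_smul_left, inner_smul_right, map_sum,
    rclike_map_mul, rclike_map_conj, hG]
  simp

theorem norm_sub_sum_of_gram
    (hG : ∀ s t, RCLike.map 𝕜 ℂ ⟪x s, x t⟫_𝕜 = ⟪y s, y t⟫_ℂ) (c : ι →₀ 𝕜) (t : ι) :
    ‖y t - Finsupp.linearCombination ℂ y
        (Finsupp.mapRange.addMonoidHom (RCLike.map 𝕜 ℂ : 𝕜 →+ ℂ) c)‖ =
      ‖x t - Finsupp.linearCombination 𝕜 x c‖ := by
  -- The difference is itself a linear combination, with coefficients δ_t - c.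
  have h := norm_linearCombination_of_gram hG (Finsupp.single t 1 - c)
  rw [map_sub, map_sub, map_sub] at h
  simpa using h

/-- Taking the best coefficients in the smaller scalar field loses nothing, as the Gram matrix
has its entries there. -/
theorem exists_coeff_norm_sub_le_of_gram
    (hG : ∀ s t, RCLike.map 𝕜 ℂ ⟪x s, x t⟫_𝕜 = ⟪y s, y t⟫_ℂ) (c' : ι →₀ ℂ) (t : ι) :
    ∃ c : ι →₀ 𝕜, c.support ⊆ c'.support ∧
      ‖x t - Finsupp.linearCombination 𝕜 x c‖ ≤ ‖y t - Finsupp.linearCombination ℂ y c'‖ := by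
  refine ⟨Finsupp.mapRange.addMonoidHom (RCLike.map ℂ 𝕜 : ℂ →+ 𝕜) c',
    Finsupp.support_mapRange (hf := map_zero _), ?_⟩
  rw [← norm_sub_sum_of_gram hG]
  -- If 𝕜 is real, the chosen coefficients are the real parts of c'. The imaginary parts contribute
  -- -i v with ⟪u, v⟫ real, so ‖u - i v‖² = ‖u‖² + ‖v‖² and dropping them only helps. If 𝕜 is
  -- complex, the coefficients are unchanged.
  rcases RCLike.I_eq_zero_or_im_I_eq_one (K := 𝕜) with hI | hI
  · have him : ∀ z : 𝕜, RCLike.im z = 0 := RCLike.im_eq_zero hI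
    have hreal : ∀ s t, (⟪y s, y t⟫_ℂ).im = 0 := fun s t => by
      rw [← hG]; simp [him]
    set u := y t - Finsupp.linearCombination ℂ y (Finsupp.mapRange.addMonoidHom
      (RCLike.map 𝕜 ℂ : 𝕜 →+ ℂ) (Finsupp.mapRange.addMonoidHom (RCLike.map ℂ 𝕜 : ℂ →+ 𝕜) c'))
      with hu
    set v := c'.sum fun i a => ((a.im : ℂ)) • y i with hv
    have huv : y t - Finsupp.linearCombination ℂ y c' = u - Complex.I • v := by
      rw [hu, hv, sub_sub]
      congr 1
      simp only [Finsupp.linearCombination_apply, Finsupp.mapRange.addMonoidHom_apply]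
      rw [Finsupp.sum_mapRange_index (by simp), Finsupp.sum_mapRange_index (by simp),
        Finsupp.smul_sum, ← Finsupp.sum_add]
      refine Finsupp.sum_congr fun i _ => ?_
      rw [smul_smul, ← add_smul]
      congr 1
      apply Complex.ext <;> simp [hI]
    have hin : (⟪u, v⟫_ℂ).im = 0 := by
      rw [hu, hv]
      simp only [Finsupp.linearCombination_apply, Finsupp.mapRange.addMonoidHom_apply]
      rw [Finsupp.sum_mapRange_index (by simp), Finsupp.sum_mapRange_index (by simp)]
      simp only [Finsupp.sum, inner_sub_left, sum_inner, inner_sum, inner_smul_left,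
        inner_smul_right, Complex.sub_im, Complex.im_sum, Complex.mul_im]
      simp [hreal, hI]
    have hsq : ‖u - Complex.I • v‖ ^ 2 = ‖u‖ ^ 2 + ‖v‖ ^ 2 := by
      rw [@norm_sub_sq ℂ, inner_smul_right, norm_smul]
      simp [hin]
    rw [huv, ← sq_le_sq₀ (norm_nonneg _) (norm_nonneg _), hsq]
    exact le_add_of_nonneg_right (sq_nonneg _)
  · refine le_of_eq ?_
    congr 3
    ext1 i
    simp only [Finsupp.mapRange.addMonoidHom_apply, Finsupp.mapRange_apply]
    apply Complex.ext <;> simp [hI]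

theorem norm_sub_starProjection_eq_of_gram
    (hG : ∀ s t, RCLike.map 𝕜 ℂ ⟪x s, x t⟫_𝕜 = ⟪y s, y t⟫_ℂ) (T : Set ι) (t : ι)
    [CompleteSpace (span 𝕜 (x '' T)).topologicalClosure]
    [CompleteSpace (span ℂ (y '' T)).topologicalClosure] :
    ‖x t - (span 𝕜 (x '' T)).topologicalClosure.starProjection (x t)‖ =
      ‖y t - (span ℂ (y '' T)).topologicalClosure.starProjection (y t)‖ := by
  apply le_antisymm
  · refine norm_sub_starProjection_le_of_coeff T x y t fun c' hc' => ?_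
    obtain ⟨c, hc, hle⟩ := exists_coeff_norm_sub_le_of_gram hG c' t
    exact ⟨c, (Finset.coe_subset.2 hc).trans hc', hle⟩
  · refine norm_sub_starProjection_le_of_coeff T y x t fun c hc => ?_
    exact ⟨Finsupp.mapRange.addMonoidHom (RCLike.map 𝕜 ℂ : 𝕜 →+ ℂ) c,
      (Finset.coe_subset.2 (Finsupp.support_mapRange (hf := map_zero _))).trans hc, (norm_sub_sum_of_gram hG c t).le⟩

end Gram

end Hilbert

/-! ### Characters as elements of L²(μ) -/

section Characters

variable {E : Type*} [NormedAddCommGroup E] [InnerProductSpace ℝ E] {d : ℕ}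

/-- The complex exponential `ω ↦ exp (i⟨ω, t⟩)`. -/
def character (t ω : E) : ℂ := Complex.exp (Complex.I * (⟪ω, t⟫_ℝ : ℂ))

theorem norm_character (t ω : E) : ‖character t ω‖ = 1 := by
  rw [character, mul_comm, Complex.norm_exp_ofReal_mul_I]

theorem continuous_character_uncurry : Continuous fun p : E × E => character p.1 p.2 := by
  unfold character; fun_prop

theorem continuous_character (t : E) : Continuous (character t) := by
  unfold character; fun_prop

theorem character_add (t ω ω' : E) :
    character t (ω + ω') = character t ω * character t ω' := by
  simp only [character, inner_add_left, Complex.ofReal_add, mul_add, Complex.exp_add]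

theorem character_add_left (s t ω : E) :
    character (s + t) ω = character s ω * character t ω := by
  simp only [character, inner_add_right, Complex.ofReal_add, mul_add, Complex.exp_add]

theorem character_neg (t ω : E) : character t (-ω) = starRingEnd ℂ (character t ω) := by
  simp [character, ← Complex.exp_conj]

theorem character_sub_left (s t ω : E) :
    character (s - t) ω = starRingEnd ℂ (character t ω) * character s ω := by
  simp only [character, inner_sub_right, ← Complex.exp_conj, ← Complex.exp_add]
  congr 1
  simp
  ring

variable [MeasurableSpace E] [BorelSpace E]

theorem memLp_character [SecondCountableTopology E] (μ : Measure E) [IsFiniteMeasure μ] (t : E) :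
    MemLp (character t) 2 μ :=
  MemLp.of_bound (continuous_character t).aestronglyMeasurable 1
    (Filter.Eventually.of_forall fun ω => (norm_character t ω).le)

/-- The class of a character in `L²(μ)`. -/
def characterLp [SecondCountableTopology E] (μ : Measure E) [IsFiniteMeasure μ] (t : E) :
    Lp ℂ 2 μ :=
  (memLp_character μ t).toLp (character t)

theorem inner_characterLp [SecondCountableTopology E] (μ : Measure E) [IsFiniteMeasure μ]
    (s t : E) : ⟪characterLp μ s, characterLp μ t⟫_ℂ = ∫ ω, character (t - s) ω ∂μ := by
  rw [L2.inner_def]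
  refine integral_congr_ae ?_
  filter_upwards [(memLp_character μ s).coeFn_toLp, (memLp_character μ t).coeFn_toLp] with ω h1 h2
  rw [characterLp, characterLp, h1, h2, character_sub_left, RCLike.inner_apply, mul_comm]

end Characters

/-! ### Lattice characters span the periodic functions -/

section Density

open UnitAddTorus

/-- Trigonometric polynomials are uniformly dense in C(torus), which is dense in L²(ν). Any finite ν
is allowed, since below ν is the push-forward of μ and not Haar measure. -/
theorem span_mFourier_toLp_closure_eq_top {ι : Type*} [Fintype ι]
    (ν : Measure (UnitAddTorus ι)) [IsFiniteMeasure ν] :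
    (Submodule.span ℂ (Set.range fun n : ι → ℤ =>
      ContinuousMap.toLp 2 ν ℂ (mFourier n))).topologicalClosure = ⊤ := by
  simpa only [Submodule.map_span, ContinuousLinearMap.coe_coe, ← Set.range_comp,
    Function.comp_def] using
    (ContinuousMap.toLp_denseRange ℂ ν ℂ (p := 2) (by simp)).topologicalClosure_map_submodule
      span_mFourier_closure_eq_top

variable {E : Type*} [NormedAddCommGroup E] [InnerProductSpace ℝ E] {d : ℕ}

/-- The coordinates of a point modulo the lattice generated by `a`. -/
def toTorus (a : Module.Basis (Fin d) ℝ E) (x : E) : UnitAddTorus (Fin d) :=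
  fun i => (a.repr x i : UnitAddCircle)

/-- The representative in the fundamental parallelepiped of `a` of a point of the torus. -/
def ofTorus (a : Module.Basis (Fin d) ℝ E) (z : UnitAddTorus (Fin d)) : E :=
  ∑ i, ((AddCircle.equivIco 1 0 (z i) : ℝ)) • a i

theorem ofTorus_toTorus (a : Module.Basis (Fin d) ℝ E) (x : E) :
    ofTorus a (toTorus a x) = ZSpan.fract a x := by
  apply a.repr.injective
  ext j
  rw [ZSpan.repr_fract_apply, ofTorus, map_sum, Finset.sum_apply']
  simp only [map_smul, Finsupp.smul_apply, Module.Basis.repr_self, smul_eq_mul, toTorus]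
  rw [Finset.sum_eq_single j]
  · simp [AddCircle.coe_equivIco_mk_apply]
  · intro i _ hij
    simp [hij]
  · simp

theorem measurable_ofTorus [MeasurableSpace E] [BorelSpace E] [SecondCountableTopology E]
    (a : Module.Basis (Fin d) ℝ E) : Measurable (ofTorus a) := by
  unfold ofTorus
  refine Finset.measurable_sum _ fun i _ => Measurable.smul_const ?_ _
  exact measurable_subtype_coe.comp
    ((AddCircle.measurableEquivIco 1 0).measurable.comp (measurable_pi_apply i))

theorem mFourier_toTorus {a b : Module.Basis (Fin d) ℝ E}
    (hab : ∀ x i, ⟪x, b i⟫_ℝ = 2 * Real.pi * a.repr x i) (n : Fin d → ℤ) (x : E) :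
    mFourier n (toTorus a x) = character (∑ i, n i • b i) x := by
  simp only [mFourier, ContinuousMap.coe_mk, toTorus, fourier_coe_apply, ← Complex.exp_sum,
    character]
  congr 1
  simp only [inner_sum, ← Int.cast_smul_eq_zsmul ℝ, real_inner_smul_right, hab,
    Complex.ofReal_sum, Finset.mul_sum]
  refine Finset.sum_congr rfl fun i _ => ?_
  push_cast
  ring

variable [FiniteDimensional ℝ E]

theorem continuous_toTorus (a : Module.Basis (Fin d) ℝ E) : Continuous (toTorus a) := by
  refine continuous_pi fun i => (AddCircle.continuous_mk' 1).comp ?_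
  exact (a.coord i).continuous_of_finiteDimensional

/-- A periodic q factors through the torus. Composition with `toTorus` is an isometry from L² of the
push-forward into L²(μ) taking monomials to lattice characters, so density on the torus transfers.
-/
theorem toLp_mem_closure_span_characterLp [MeasurableSpace E] [BorelSpace E]
    {a b : Module.Basis (Fin d) ℝ E}
    (hab : ∀ x i, ⟪x, b i⟫_ℝ = 2 * Real.pi * a.repr x i) (μ : Measure E) [IsFiniteMeasure μ]
    {q : E → ℂ} (hq : Measurable q) (hper : ∀ x, q (ZSpan.fract a x) = q x)
    (hL : MemLp q 2 μ) :
    hL.toLp q ∈ (Submodule.span ℂ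
      (characterLp μ '' (Submodule.span ℤ (Set.range b) : Set E))).topologicalClosure := by
  set K := Submodule.span ℂ (characterLp μ '' (Submodule.span ℤ (Set.range b) : Set E))
  have hφ : MeasurePreserving (toTorus a) μ (μ.map (toTorus a)) :=
    (continuous_toTorus a).measurable.measurePreserving μ
  have hfac : q = (q ∘ ofTorus a) ∘ toTorus a := by
    ext x; simp [ofTorus_toTorus, hper]
  have hg : Measurable (q ∘ ofTorus a) := hq.comp (measurable_ofTorus a)
  have hgL : MemLp (q ∘ ofTorus a) 2 (μ.map (toTorus a)) := by
    rw [memLp_map_measure_iff hg.aestronglyMeasurable hφ.measurable.aemeasurable, ← hfac]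
    exact hL
  let Φ := Lp.compMeasurePreservingₗᵢ ℂ (E := ℂ) (p := 2) (toTorus a) hφ
  have hΦ : Φ (hgL.toLp _) = hL.toLp q := by
    change Lp.compMeasurePreserving _ hφ _ = _
    rw [Lp.toLp_compMeasurePreserving hgL hφ]
    congr 1
    exact hfac.symm
  have hle : (Submodule.span ℂ (Set.range fun n : Fin d → ℤ =>
      ContinuousMap.toLp 2 (μ.map (toTorus a)) ℂ (mFourier n))).topologicalClosure ≤
        K.topologicalClosure.comap Φ.toLinearMap := by
    refine Submodule.topologicalClosure_minimal _ (Submodule.span_le.2 ?_)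
      (K.isClosed_topologicalClosure.preimage Φ.continuous)
    rintro _ ⟨n, rfl⟩
    refine K.le_topologicalClosure (Submodule.subset_span ?_)
    refine ⟨∑ i, n i • b i, ?_, ?_⟩
    · exact sum_mem fun i _ => zsmul_mem (Submodule.subset_span (Set.mem_range_self i)) _
    · apply Lp.ext
      refine (memLp_character μ _).coeFn_toLp.trans ?_
      refine Filter.EventuallyEq.symm ((Lp.coeFn_compMeasurePreserving _ hφ).trans ?_)
      filter_upwards [hφ.quasiMeasurePreserving.ae
        (ContinuousMap.coeFn_toLp (p := 2) (μ.map (toTorus a)) (𝕜 := ℂ) (mFourier n))] with x hx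
      rw [Function.comp_apply, hx, mFourier_toTorus hab]
  rw [← hΦ]
  rw [span_mFourier_toLp_closure_eq_top] at hle
  exact hle Submodule.mem_top

end Density

/-! ### Folding Δ modulo Λ(A) and the projection of a character -/

section Folding

variable {E : Type*} [NormedAddCommGroup E] [InnerProductSpace ℝ E] {d : ℕ}
  {a : Module.Basis (Fin d) ℝ E}

open Classical in
/-- The shifts in `F` that take `u` into `Δ`. -/
def activeShifts (F : Finset (Submodule.span ℤ (Set.range a))) (Δ : Set E) (u : E) :
    Finset (Submodule.span ℤ (Set.range a)) :=
  F.filter fun k => (k : E) + u ∈ Δ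

/-- `F` contains every lattice vector that takes a point of the fundamental parallelepiped
into `Δ`. -/
def CoversShifts (F : Finset (Submodule.span ℤ (Set.range a))) (Δ : Set E) : Prop :=
  ∀ k : Submodule.span ℤ (Set.range a), ∀ u ∈ ZSpan.fundamentalDomain a, (k : E) + u ∈ Δ → k ∈ F

open scoped Pointwise in
-- Such shifts lie in the bounded difference set of Δ and the parallelepiped, which contains
-- finitely many lattice points. Sums over cosets thus become finite sums.
theorem exists_coversShifts [FiniteDimensional ℝ E] (a : Module.Basis (Fin d) ℝ E) {Δ : Set E}
    (hΔ : Bornology.IsBounded Δ) :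
    ∃ F : Finset (Submodule.span ℤ (Set.range a)), CoversShifts F Δ := by
  have hfin := ZSpan.setFinite_inter a (hΔ.sub (ZSpan.fundamentalDomain_isBounded a))
  have hfin' : {k : Submodule.span ℤ (Set.range a) |
      (k : E) ∈ Δ - ZSpan.fundamentalDomain a}.Finite := by
    refine Set.Finite.of_finite_image (hfin.subset ?_) Subtype.val_injective.injOn
    rintro _ ⟨k, hk, rfl⟩
    exact ⟨hk, k.2⟩
  refine ⟨hfin'.toFinset, fun k u hu hk => ?_⟩
  rw [Set.Finite.mem_toFinset]
  exact ⟨_, hk, u, hu, by simp⟩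

/-- The sum of the values of `f` at the lattice translates of `u` that lie in `Δ`. -/
def foldSum {G : Type*} [AddCommMonoid G] (F : Finset (Submodule.span ℤ (Set.range a)))
    (Δ : Set E) (f : E → G) (u : E) : G :=
  ∑ k ∈ activeShifts F Δ u, f (k + u)

theorem foldSum_eq_sum_indicator {G : Type*} [AddCommMonoid G]
    (F : Finset (Submodule.span ℤ (Set.range a))) (Δ : Set E) (f : E → G) (u : E) :
    foldSum F Δ f u = ∑ k ∈ F, Δ.indicator f (k + u) := by
  classical
  simp only [foldSum, activeShifts, Set.indicator_apply]
  rw [Finset.sum_filter]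

theorem card_activeShifts_eq_sum (F : Finset (Submodule.span ℤ (Set.range a))) (Δ : Set E)
    (u : E) :
    ((activeShifts F Δ u).card : ℝ) = ∑ k ∈ F, Δ.indicator (fun _ => (1 : ℝ)) (k + u) := by
  rw [← foldSum_eq_sum_indicator, foldSum]
  simp

theorem norm_foldSum_character_le (F : Finset (Submodule.span ℤ (Set.range a))) (Δ : Set E)
    (t u : E) : ‖foldSum F Δ (character t) u‖ ≤ (activeShifts F Δ u).card := by
  refine (norm_sum_le _ _).trans ?_
  simp [norm_character]

variable [MeasurableSpace E] [BorelSpace E]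

theorem measurable_card_activeShifts (F : Finset (Submodule.span ℤ (Set.range a))) {Δ : Set E}
    (hΔ : MeasurableSet Δ) : Measurable fun u => ((activeShifts F Δ u).card : ℝ) := by
  simp only [card_activeShifts_eq_sum]
  exact Finset.measurable_sum _ fun k _ =>
    (measurable_const.indicator hΔ).comp (measurable_const_add (k : E))

variable [FiniteDimensional ℝ E]

theorem measurable_foldSum_character_uncurry (F : Finset (Submodule.span ℤ (Set.range a)))
    {Δ : Set E} (hΔ : MeasurableSet Δ) :
    Measurable fun p : E × E => foldSum F Δ (character p.1) p.2 := by
  have h : (fun p : E × E => foldSum F Δ (character p.1) p.2) = fun p => ∑ k ∈ F,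
      ((fun p : E × E => (k : E) + p.2) ⁻¹' Δ).indicator
        (fun p => character p.1 (k + p.2)) p := by
    ext p
    simp only [foldSum_eq_sum_indicator]
    rfl
  rw [h]
  refine Finset.measurable_sum _ fun k _ => Measurable.indicator ?_ ?_
  · have := continuous_character_uncurry (E := E)
    exact (this.comp (by fun_prop : Continuous fun p : E × E => (p.1, (k : E) + p.2))).measurable
  · exact (measurable_snd.const_add (k : E)) hΔ

theorem setIntegral_eq_integral_foldSum {G : Type*} [NormedAddCommGroup G] [NormedSpace ℝ G]
    {F : Finset (Submodule.span ℤ (Set.range a))} {Δ : Set E} (hF : CoversShifts F Δ)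
    (hΔ : MeasurableSet Δ) {f : E → G} (hf : IntegrableOn f Δ) :
    ∫ ω in Δ, f ω = ∫ u in ZSpan.fundamentalDomain a, foldSum F Δ f u := by
  have hint : Integrable (Δ.indicator f) := (integrable_indicator_iff hΔ).2 hf
  rw [← integral_indicator hΔ, (ZSpan.isAddFundamentalDomain a volume).integral_eq_tsum'' _ hint,
    tsum_eq_sum (s := F)]
  · simp only [foldSum_eq_sum_indicator]
    exact (integral_finsetSum F (f := fun (k : Submodule.span ℤ (Set.range a)) x =>
      Δ.indicator f ((k : E) + x)) fun k _ => (hint.comp_add_left (k : E)).integrableOn).symm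
  · intro k hk
    refine setIntegral_eq_zero_of_forall_eq_zero fun u hu => Set.indicator_of_notMem ?_ _
    exact fun h => hk (hF k u hu h)

/-- The conditional expectation of `character t` on `Δ` given the class modulo the lattice. -/
def periodization (F : Finset (Submodule.span ℤ (Set.range a))) (Δ : Set E) (t ω : E) : ℂ :=
  foldSum F Δ (character t) (ZSpan.fract a ω) / (activeShifts F Δ (ZSpan.fract a ω)).card

theorem measurable_fract : Measurable (ZSpan.fract a) := by
  have : ZSpan.fract a = ofTorus a ∘ toTorus a := funext fun x => (ofTorus_toTorus a x).symm
  rw [this]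
  exact (measurable_ofTorus a).comp (continuous_toTorus a).measurable

theorem measurable_periodization (F : Finset (Submodule.span ℤ (Set.range a))) {Δ : Set E}
    (hΔ : MeasurableSet Δ) (t : E) : Measurable (periodization F Δ t) := by
  have h1 : Measurable (foldSum F Δ (character t)) :=
    Measurable.of_uncurry_left (f := fun t u => foldSum F Δ (character t) u)
      (measurable_foldSum_character_uncurry F hΔ)
  have h2 : Measurable fun u => ((activeShifts F Δ u).card : ℂ) := by
    simpa [Function.comp_def] using
      Complex.measurable_ofReal.comp (measurable_card_activeShifts F hΔ)
  exact (h1.div h2).comp (measurable_fract (a := a))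

omit [MeasurableSpace E] [BorelSpace E] [FiniteDimensional ℝ E] in
theorem norm_periodization_le (F : Finset (Submodule.span ℤ (Set.range a))) (Δ : Set E)
    (t ω : E) : ‖periodization F Δ t ω‖ ≤ 1 := by
  rw [periodization, norm_div, Complex.norm_natCast]
  exact div_le_one_of_le₀ (norm_foldSum_character_le F Δ t _) (Nat.cast_nonneg _)

omit [MeasurableSpace E] [BorelSpace E] [FiniteDimensional ℝ E] in
theorem periodization_fract (F : Finset (Submodule.span ℤ (Set.range a))) (Δ : Set E)
    (t ω : E) : periodization F Δ t (ZSpan.fract a ω) = periodization F Δ t ω := by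
  simp [periodization, ZSpan.fract_fract]

omit [MeasurableSpace E] [BorelSpace E] [FiniteDimensional ℝ E] in
theorem periodization_add (F : Finset (Submodule.span ℤ (Set.range a))) (Δ : Set E)
    (t : E) (k : Submodule.span ℤ (Set.range a)) (u : E) :
    periodization F Δ t (k + u) = periodization F Δ t u := by
  simp [periodization, ZSpan.fract_zSpan_add a u k.2]

omit [MeasurableSpace E] [BorelSpace E] [FiniteDimensional ℝ E] in
theorem card_mul_periodization (F : Finset (Submodule.span ℤ (Set.range a))) (Δ : Set E)
    (t : E) {u : E} (hu : u ∈ ZSpan.fundamentalDomain a) :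
    (activeShifts F Δ u).card * periodization F Δ t u = foldSum F Δ (character t) u := by
  rw [periodization, ZSpan.fract_eq_self.2 hu]
  -- With no active shift the quotient is 0 / 0 = 0, and the identity still holds.
  by_cases h : activeShifts F Δ u = ∅
  · simp [foldSum, h]
  · rw [mul_div_cancel₀]
    simpa using h

omit [MeasurableSpace E] [BorelSpace E] [FiniteDimensional ℝ E] in
theorem foldSum_norm_sq_periodization (F : Finset (Submodule.span ℤ (Set.range a))) (Δ : Set E)
    (t : E) {u : E} (hu : u ∈ ZSpan.fundamentalDomain a) :
    foldSum F Δ (fun ω => ‖periodization F Δ t ω‖ ^ 2) u =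
      ‖foldSum F Δ (character t) u‖ ^ 2 / (activeShifts F Δ u).card := by
  rw [foldSum]
  simp only [periodization_add, Finset.sum_const, nsmul_eq_mul]
  rw [periodization, ZSpan.fract_eq_self.2 hu, norm_div, Complex.norm_natCast]
  by_cases h : ((activeShifts F Δ u).card : ℝ) = 0
  · simp [h]
  · field_simp

omit [MeasurableSpace E] [BorelSpace E] [FiniteDimensional ℝ E] in
theorem character_lattice {b : Module.Basis (Fin d) ℝ E}
    (hab : ∀ x i, ⟪x, b i⟫_ℝ = 2 * Real.pi * a.repr x i) {k t : E}
    (hk : k ∈ Submodule.span ℤ (Set.range a)) (ht : t ∈ Submodule.span ℤ (Set.range b)) :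
    character t k = 1 := by
  have hk' : k ∈ scaledDual (Submodule.span ℤ (Set.range b)) := by
    rw [scaledDual_span hab]; exact hk
  obtain ⟨n, hn⟩ := hk' t ht
  rw [character, hn, Complex.exp_eq_one_iff]
  exact ⟨n, by push_cast; ring⟩

theorem memLp_periodization (F : Finset (Submodule.span ℤ (Set.range a))) {Δ : Set E}
    (hΔ : MeasurableSet Δ) (t : E) (μ : Measure E) [IsFiniteMeasure μ] :
    MemLp (periodization F Δ t) 2 μ :=
  MemLp.of_bound (measurable_periodization F hΔ t).aestronglyMeasurable 1
    (Filter.Eventually.of_forall fun ω => norm_periodization_le F Δ t ω)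

/-- For s in Λ(B) the character is constant on Λ(A)-cosets, so it factors out of the folded sum; the
deviations from the coset mean sum to zero. -/
theorem setIntegral_conj_mul_sub_periodization {b : Module.Basis (Fin d) ℝ E}
    (hab : ∀ x i, ⟪x, b i⟫_ℝ = 2 * Real.pi * a.repr x i)
    {F : Finset (Submodule.span ℤ (Set.range a))} {Δ : Set E} (hF : CoversShifts F Δ)
    (hΔ : MeasurableSet Δ) (hfin : volume Δ ≠ ⊤) (t : E) {s : E}
    (hs : s ∈ Submodule.span ℤ (Set.range b)) :
    ∫ ω in Δ, starRingEnd ℂ (character s ω) * (character t ω - periodization F Δ t ω) = 0 := by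
  have hint : IntegrableOn
      (fun ω => starRingEnd ℂ (character s ω) * (character t ω - periodization F Δ t ω)) Δ := by
    refine Measure.integrableOn_of_bounded (M := 2) hfin ?_ ?_
    · have h1 := (continuous_character s).measurable
      have h2 := (continuous_character t).measurable
      have h3 := measurable_periodization F hΔ t
      exact ((Complex.continuous_conj.measurable.comp h1).mul (h2.sub h3)).aestronglyMeasurable
    · refine Filter.Eventually.of_forall fun ω => ?_
      rw [norm_mul, RCLike.norm_conj, norm_character, one_mul]
      refine (norm_sub_le _ _).trans ?_
      linarith [norm_periodization_le F Δ t ω, norm_character t ω]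
  rw [setIntegral_eq_integral_foldSum hF hΔ hint]
  refine setIntegral_eq_zero_of_forall_eq_zero fun u hu => ?_
  have h : ∀ k : Submodule.span ℤ (Set.range a), character s ((k : E) + u) = character s u := by
    intro k
    rw [character_add, character_lattice hab k.2 hs, one_mul]
  simp only [foldSum, h, periodization_add, ← Finset.mul_sum, Finset.sum_sub_distrib,
    Finset.sum_const, nsmul_eq_mul, card_mul_periodization F Δ t hu]
  simp

/-- The periodization lies in the closed span and its residual is orthogonal to every generator, so
it is the projection. Pythagoras and folding then give the formula. -/
theorem norm_sq_sub_starProjection_characterLp {b : Module.Basis (Fin d) ℝ E}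
    (hab : ∀ x i, ⟪x, b i⟫_ℝ = 2 * Real.pi * a.repr x i)
    {F : Finset (Submodule.span ℤ (Set.range a))} {Δ : Set E} (hF : CoversShifts F Δ)
    (hΔ : MeasurableSet Δ) (hfin : volume Δ ≠ ⊤) (c : NNReal) (μ : Measure E) [IsFiniteMeasure μ]
    (hμ : μ = c • volume.restrict Δ) (t : E)
    [CompleteSpace (Submodule.span ℂ (characterLp μ ''
      (Submodule.span ℤ (Set.range b) : Set E))).topologicalClosure] :
    ‖characterLp μ t - (Submodule.span ℂ (characterLp μ ''
        (Submodule.span ℤ (Set.range b) : Set E))).topologicalClosure.starProjection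
          (characterLp μ t)‖ ^ 2 =
      c * (volume.real Δ - ∫ u in ZSpan.fundamentalDomain a,
        ‖foldSum F Δ (character t) u‖ ^ 2 / (activeShifts F Δ u).card) := by
  set K := Submodule.span ℂ (characterLp μ '' (Submodule.span ℤ (Set.range b) : Set E))
  have hP := memLp_periodization F hΔ t μ
  have hmem : hP.toLp _ ∈ K.topologicalClosure :=
    toLp_mem_closure_span_characterLp hab μ (measurable_periodization F hΔ t)
      (periodization_fract F Δ t) hP
  have horth : characterLp μ t - hP.toLp _ ∈ K.topologicalClosureᗮ := by
    rw [Submodule.orthogonal_closure, Submodule.mem_orthogonal]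
    intro v hv
    induction hv using Submodule.span_induction with
    | mem v hv =>
      obtain ⟨s, hs, rfl⟩ := hv
      have h := setIntegral_conj_mul_sub_periodization hab hF hΔ hfin t hs
      rw [characterLp, characterLp, ← MemLp.toLp_sub, L2.inner_def]
      trans ∫ ω, starRingEnd ℂ (character s ω) * (character t ω - periodization F Δ t ω) ∂μ
      · refine integral_congr_ae ?_
        filter_upwards [(memLp_character μ s).coeFn_toLp,
          ((memLp_character μ t).sub hP).coeFn_toLp] with ω h1 h2
        rw [h1, h2, RCLike.inner_apply, mul_comm, Pi.sub_apply]
      · rw [hμ, integral_smul_nnreal_measure, h, smul_zero]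
    | zero => simp
    | add v w _ _ hv hw => rw [inner_add_left, hv, hw, add_zero]
    | smul z v _ hv => rw [inner_smul_left, hv, mul_zero]
  have hproj := Submodule.eq_starProjection_of_mem_orthogonal hmem horth
  have hpyth := Submodule.norm_sq_eq_add_norm_sq_starProjection (characterLp μ t)
    K.topologicalClosure
  rw [Submodule.starProjection_orthogonal_val, hproj] at hpyth
  have hnorm : ∀ {f : E → ℂ} (hf : MemLp f 2 μ), ‖hf.toLp f‖ ^ 2 = c * ∫ ω in Δ, ‖f ω‖ ^ 2 := by
    intro f hf
    rw [← @inner_self_eq_norm_sq ℂ, L2.inner_def, ← integral_re (L2.integrable_inner _ _)]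
    trans ∫ ω, ‖f ω‖ ^ 2 ∂μ
    · refine integral_congr_ae ?_
      filter_upwards [hf.coeFn_toLp] with ω hω
      rw [hω, inner_self_eq_norm_sq]
    · rw [hμ, integral_smul_nnreal_measure, NNReal.smul_def, smul_eq_mul]
  have hfold : ∫ ω in Δ, ‖periodization F Δ t ω‖ ^ 2 = ∫ u in ZSpan.fundamentalDomain a,
      ‖foldSum F Δ (character t) u‖ ^ 2 / (activeShifts F Δ u).card := by
    rw [setIntegral_eq_integral_foldSum hF hΔ, setIntegral_congr_fun
      (ZSpan.fundamentalDomain_measurableSet a)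
      fun u hu => foldSum_norm_sq_periodization F Δ t hu]
    refine Measure.integrableOn_of_bounded (M := 1) hfin
      ((measurable_periodization F hΔ t).norm.pow_const 2).aestronglyMeasurable
      (Filter.Eventually.of_forall fun ω => ?_)
    rw [norm_pow, norm_norm]
    exact pow_le_one₀ (norm_nonneg _) (norm_periodization_le F Δ t ω)
  rw [hproj, ← add_left_cancel_iff (a := ‖hP.toLp _‖ ^ 2), ← hpyth, characterLp, hnorm, hnorm,
    hfold]
  simp only [norm_character]
  simp
  ring

end Folding

/-! ### Averaging over a fundamental domain of the sampling lattice -/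

section Averaging

variable {E : Type*} [NormedAddCommGroup E] [InnerProductSpace ℝ E] [FiniteDimensional ℝ E]
  [MeasurableSpace E] [BorelSpace E] {d : ℕ} {a b : Module.Basis (Fin d) ℝ E}

/-- The translate v + V is again a fundamental domain, and an invariant function has the same
integral over both. -/
theorem setIntegral_vadd_invariant {L : Submodule ℤ E} [Countable L] {V : Set E}
    (hV : IsAddFundamentalDomain L V (volume : Measure E)) {f : E → ℂ}
    (hf : ∀ (g : L) (x : E), f ((g : E) + x) = f x) (v : E) :
    ∫ x in V, f (v + x) = ∫ x in V, f x := by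
  have h1 := (measurePreserving_add_left (volume : Measure E) v).setIntegral_image_emb
    (MeasurableEquiv.addLeft v).measurableEmbedding f V
  have h2 := (hV.vadd_of_comm v).setIntegral_eq hV (f := f) hf
  rw [← h1, ← h2]
  rfl

theorem setIntegral_character_of_ne_zero
    (hab : ∀ x i, ⟪x, b i⟫_ℝ = 2 * Real.pi * a.repr x i) {V : Set E}
    (hV : IsAddFundamentalDomain (Submodule.span ℤ (Set.range b)) V (volume : Measure E))
    {k : E} (hk : k ∈ Submodule.span ℤ (Set.range a)) (hk0 : k ≠ 0) :
    ∫ t in V, character t k = 0 := by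
  -- The shift πk/‖k‖² has inner product π with k, so it multiplies the character by -1: the
  -- integral equals its own negative.
  have h := setIntegral_vadd_invariant hV (f := fun t => character t k) (fun g x => by
    simp only [character_add_left, character_lattice hab hk g.2, one_mul])
    ((Real.pi / ‖k‖ ^ 2) • k)
  have hval : character ((Real.pi / ‖k‖ ^ 2) • k) k = -1 := by
    have : ‖k‖ ≠ 0 := by simpa using hk0
    rw [character, real_inner_smul_right, real_inner_self_eq_norm_sq,
      div_mul_cancel₀ _ (pow_ne_zero 2 this), mul_comm, Complex.exp_pi_mul_I]
  simp only [character_add_left, hval, neg_one_mul, integral_neg] at h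
  exact self_eq_neg.1 h.symm

theorem setIntegral_norm_sq_sum_character
    (hab : ∀ x i, ⟪x, b i⟫_ℝ = 2 * Real.pi * a.repr x i) {V : Set E}
    (hV : IsAddFundamentalDomain (Submodule.span ℤ (Set.range b)) V (volume : Measure E))
    (hfin : volume V ≠ ⊤) (S : Finset (Submodule.span ℤ (Set.range a))) (u : E) :
    ∫ t in V, ‖∑ k ∈ S, character t ((k : E) + u)‖ ^ 2 = volume.real V * S.card := by
  have hexp : ∀ t, ((‖∑ k ∈ S, character t ((k : E) + u)‖ ^ 2 : ℝ) : ℂ) =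
      ∑ k ∈ S, ∑ l ∈ S, character t ((k : E) - l) := by
    intro t
    rw [Complex.ofReal_pow, ← Complex.mul_conj', map_sum, Finset.sum_mul_sum]
    refine Finset.sum_congr rfl fun k _ => Finset.sum_congr rfl fun l _ => ?_
    rw [← character_neg, ← character_add]
    congr 1
    abel
  have hint : ∀ x : E, IntegrableOn (fun t => character t x) V := fun x =>
    Measure.integrableOn_of_bounded (M := 1) hfin
      (continuous_character_uncurry.comp
        (by fun_prop : Continuous fun t : E => (t, x))).aestronglyMeasurable
      (Filter.Eventually.of_forall fun t => (norm_character t x).le)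
  apply Complex.ofReal_injective
  rw [← integral_complex_ofReal]
  simp only [hexp]
  rw [integral_finsetSum _ fun k _ => integrable_finsetSum _ fun l _ => hint _]
  have hrow : ∀ k ∈ S, ∫ t in V, ∑ l ∈ S, character t ((k : E) - l) = volume.real V := by
    intro k hk
    rw [integral_finsetSum _ fun l _ => hint _, Finset.sum_eq_single_of_mem k hk]
    · simp [character]
    · intro l _ hlk
      exact setIntegral_character_of_ne_zero hab hV (sub_mem k.2 l.2)
        (sub_ne_zero.2 fun h => hlk (Subtype.ext h.symm))
  rw [Finset.sum_congr rfl hrow]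
  simp [mul_comm]

variable {F : Finset (Submodule.span ℤ (Set.range a))} {Δ : Set E}

/-- Bounded by |F|, since |s|² / N ≤ N ≤ |F|. This licenses Fubini, and later the integrability of
the error variance. -/
theorem integrable_foldSum_ratio (hΔ : MeasurableSet Δ) {V D : Set E}
    (hV : volume V ≠ ⊤) (hD : volume D ≠ ⊤) :
    Integrable (fun p : E × E => ‖foldSum F Δ (character p.1) p.2‖ ^ 2 /
      ((activeShifts F Δ p.2).card : ℝ)) ((volume.restrict V).prod (volume.restrict D)) := by
  have : IsFiniteMeasure (volume.restrict V) := isFiniteMeasure_restrict.2 hV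
  have : IsFiniteMeasure (volume.restrict D) := isFiniteMeasure_restrict.2 hD
  refine Integrable.of_bound (((measurable_foldSum_character_uncurry F hΔ).norm.pow_const 2).div
    ((measurable_card_activeShifts F hΔ).comp measurable_snd)).aestronglyMeasurable F.card
    (Filter.Eventually.of_forall fun p => ?_)
  have h1 := norm_foldSum_character_le F Δ p.1 p.2
  have h2 : ((activeShifts F Δ p.2).card : ℝ) ≤ F.card := by
    classical
    exact_mod_cast Finset.card_filter_le _ _
  rw [Real.norm_of_nonneg (by positivity)]
  refine le_trans (div_le_of_le_mul₀ (Nat.cast_nonneg _) (Nat.cast_nonneg _) ?_) h2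
  rw [← sq]
  exact pow_le_pow_left₀ (norm_nonneg _) h1 2

/-- After Fubini the inner integral is vol V · N(u) / N(u), which is vol V where N(u) > 0 and 0
elsewhere. -/
theorem setIntegral_setIntegral_foldSum_ratio
    (hab : ∀ x i, ⟪x, b i⟫_ℝ = 2 * Real.pi * a.repr x i) {V : Set E}
    (hV : IsAddFundamentalDomain (Submodule.span ℤ (Set.range b)) V (volume : Measure E))
    (hfin : volume V ≠ ⊤) (hF : CoversShifts F Δ) (hΔ : MeasurableSet Δ) :
    ∫ t in V, ∫ u in ZSpan.fundamentalDomain a, ‖foldSum F Δ (character t) u‖ ^ 2 /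
        ((activeShifts F Δ u).card : ℝ) =
      volume.real V * volume.real ({x : E | ∃ k : Submodule.span ℤ (Set.range a), k +ᵥ x ∈ Δ} ∩
        ZSpan.fundamentalDomain a) := by
  have hD : volume (ZSpan.fundamentalDomain a) ≠ ⊤ :=
    (ZSpan.fundamentalDomain_isBounded a).measure_lt_top.ne
  have hmeas : MeasurableSet {x : E | ∃ k : Submodule.span ℤ (Set.range a), k +ᵥ x ∈ Δ} := by
    rw [Set.ofPred_exists]
    exact MeasurableSet.iUnion fun k => hΔ.preimage (measurable_const_vadd k)
  have hDm := ZSpan.fundamentalDomain_measurableSet a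
  rw [integral_integral_swap (integrable_foldSum_ratio hΔ hfin hD)]
  trans ∫ u in ZSpan.fundamentalDomain a,
    {x : E | ∃ k : Submodule.span ℤ (Set.range a), k +ᵥ x ∈ Δ}.indicator
      (fun _ => volume.real V) u
  · refine setIntegral_congr_fun hDm fun u hu => ?_
    simp only [integral_div, foldSum]
    rw [setIntegral_norm_sq_sum_character hab hV hfin]
    by_cases h : ∃ k : Submodule.span ℤ (Set.range a), k +ᵥ u ∈ Δ
    · obtain ⟨k, hk⟩ := h
      have hmem : k ∈ activeShifts F Δ u := by
        classical
        exact Finset.mem_filter.2 ⟨hF k u hu hk, hk⟩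
      have hne : ((activeShifts F Δ u).card : ℝ) ≠ 0 := by
        exact_mod_cast (Finset.card_pos.2 ⟨k, hmem⟩).ne'
      rw [Set.indicator_of_mem (Set.mem_ofPred_eq ▸ ⟨k, hk⟩), mul_div_cancel_right₀ _ hne]
    · have hemp : activeShifts F Δ u = ∅ := by
        classical
        exact Finset.filter_eq_empty_iff.2 fun k _ hk => h ⟨k, hk⟩
      rw [Set.indicator_of_notMem (by exact h), hemp]
      simp
  · rw [setIntegral_indicator hmeas, setIntegral_const, smul_eq_mul, mul_comm, Set.inter_comm]

end Averaging

/-! ### From the process to its spectral model -/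

section ErrorVariance

variable {E : Type*} [NormedAddCommGroup E] [InnerProductSpace ℝ E] [FiniteDimensional ℝ E]
  [MeasurableSpace E] [BorelSpace E] {Ω : Type*} [MeasurableSpace Ω] {P : Measure Ω}
  {𝕜 : Type*} [RCLike 𝕜] {X : E → Ω → 𝕜} {d : ℕ}

/-- The spectral representation at lag t - s, read as an identity of Gram matrices. -/
theorem map_inner_toLp_eq_integral_character {S₀ ω₀ : ℝ} (hS₀ : 0 ≤ S₀)
    (hX : IsStationary P X) (hS : HasSpectralDensity P X (flatSpectrum S₀ ω₀)) (s t : E) :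
    RCLike.map 𝕜 ℂ ⟪(hX.memLp s).toLp (X s), (hX.memLp t).toLp (X t)⟫_𝕜 =
      ∫ ω, character (t - s) ω ∂((((2 * Real.pi) ^ Module.finrank ℝ E)⁻¹ * S₀).toNNReal •
        volume.restrict (Metric.closedBall (0 : E) ω₀)) := by
  have h := hS.autocorr_eq (t - s) s
  rw [add_sub_cancel] at h
  have hin : ⟪(hX.memLp s).toLp (X s), (hX.memLp t).toLp (X t)⟫_𝕜 = autocorr P X t s := by
    rw [L2.inner_def, autocorr]
    refine integral_congr_ae ?_
    filter_upwards [(hX.memLp s).coeFn_toLp, (hX.memLp t).coeFn_toLp] with w h1 h2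
    rw [h1, h2, RCLike.inner_apply]
  rw [hin, h, integral_smul_nnreal_measure, NNReal.smul_def, Real.coe_toNNReal _ (by positivity)]
  have hind : (fun ω : E => (flatSpectrum S₀ ω₀ ω : ℂ) *
      Complex.exp (Complex.I * (⟪ω, t - s⟫_ℝ : ℂ))) =
      (Metric.closedBall (0 : E) ω₀).indicator fun ω => (S₀ : ℂ) * character (t - s) ω := by
    ext ω
    by_cases hω : ω ∈ Metric.closedBall (0 : E) ω₀ <;> simp [flatSpectrum, hω, character]
  rw [hind, integral_indicator Metric.isClosed_closedBall.measurableSet, integral_const_mul,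
    Complex.real_smul]
  push_cast
  ring

omit [InnerProductSpace ℝ E] [FiniteDimensional ℝ E] [MeasurableSpace E] [BorelSpace E] in
theorem errorVarianceAt_eq_norm_sq (hX : IsStationary P X) (L : Submodule ℤ E) (t : E) :
    errorVarianceAt hX L t =
      ‖(hX.memLp t).toLp (X t) - bestLinearInterpolator hX L t‖ ^ 2 := by
  rw [← @inner_self_eq_norm_sq 𝕜, L2.inner_def, ← integral_re (L2.integrable_inner _ _),
    errorVarianceAt]
  refine integral_congr_ae ?_
  filter_upwards [(hX.memLp t).coeFn_toLp,
    Lp.coeFn_sub ((hX.memLp t).toLp (X t)) (bestLinearInterpolator hX L t)] with w h1 h2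
  rw [h2, inner_self_eq_norm_sq, Pi.sub_apply, h1]

theorem errorVarianceAt_flatSpectrum {a b : Module.Basis (Fin d) ℝ E}
    (hab : ∀ x i, ⟪x, b i⟫_ℝ = 2 * Real.pi * a.repr x i) {S₀ ω₀ : ℝ} (hS₀ : 0 ≤ S₀)
    (hX : IsStationary P X) (hS : HasSpectralDensity P X (flatSpectrum S₀ ω₀))
    {F : Finset (Submodule.span ℤ (Set.range a))}
    (hF : CoversShifts F (Metric.closedBall (0 : E) ω₀)) (t : E) :
    errorVarianceAt hX (lattice b) t =
      ((2 * Real.pi) ^ Module.finrank ℝ E)⁻¹ * S₀ * (volume.real (Metric.closedBall (0 : E) ω₀) -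
        ∫ u in ZSpan.fundamentalDomain a,
          ‖foldSum F (Metric.closedBall (0 : E) ω₀) (character t) u‖ ^ 2 /
            (activeShifts F (Metric.closedBall (0 : E) ω₀) u).card) := by
  set c : NNReal := (((2 * Real.pi) ^ Module.finrank ℝ E)⁻¹ * S₀).toNNReal with hc
  have hball : volume (Metric.closedBall (0 : E) ω₀) ≠ ⊤ :=
    Metric.isBounded_closedBall.measure_lt_top.ne
  have : IsFiniteMeasure (volume.restrict (Metric.closedBall (0 : E) ω₀)) :=
    isFiniteMeasure_restrict.2 hball
  set μ : Measure E := c • volume.restrict (Metric.closedBall (0 : E) ω₀) with hμ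
  have hG : ∀ s t, RCLike.map 𝕜 ℂ ⟪(hX.memLp s).toLp (X s), (hX.memLp t).toLp (X t)⟫_𝕜 =
      ⟪characterLp μ s, characterLp μ t⟫_ℂ := fun s t => by
    rw [inner_characterLp, map_inner_toLp_eq_integral_character hS₀ hX hS]
  have : CompleteSpace (sampleSpan hX (lattice b)) :=
    (Submodule.isClosed_topologicalClosure _).completeSpace_coe
  have : CompleteSpace (Submodule.span ℂ (characterLp μ ''
      (Submodule.span ℤ (Set.range b) : Set E))).topologicalClosure :=
    (Submodule.isClosed_topologicalClosure _).completeSpace_coe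
  have hdist := norm_sub_starProjection_eq_of_gram hG (Submodule.span ℤ (Set.range b) : Set E) t
  have herr := norm_sq_sub_starProjection_characterLp hab hF
    Metric.isClosed_closedBall.measurableSet hball c μ hμ t
  rw [← hdist, hc, Real.coe_toNNReal _ (by positivity)] at herr
  rw [errorVarianceAt_eq_norm_sq]
  exact herr

end ErrorVariance

end LatticeSampling

end

open LatticeSampling in
theorem theorem1 {d : ℕ}
    {E : Type*} [NormedAddCommGroup E] [InnerProductSpace ℝ E] [FiniteDimensional ℝ E]
    [MeasurableSpace E] [BorelSpace E]
    {Ω : Type*} [MeasurableSpace Ω] (P : Measure Ω) [IsProbabilityMeasure P]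
    {𝕜 : Type*} [RCLike 𝕜]
    (B : Module.Basis (Fin d) ℝ E) (A : Fin d → E)
    (hA : (LatticeSampling.lattice A : Set E) =
      LatticeSampling.scaledDual (LatticeSampling.lattice B))
    (S₀ ω₀ : ℝ) (hS₀ : 0 ≤ S₀) (hω₀ : 0 < ω₀)
    (X : E → Ω → 𝕜) (hX : LatticeSampling.IsStationary P X)
    (hS : LatticeSampling.HasSpectralDensity P X (LatticeSampling.flatSpectrum S₀ ω₀)) :
    IntegrableOn (LatticeSampling.errorVarianceAt hX (LatticeSampling.lattice B))
        (LatticeSampling.voronoiCell (LatticeSampling.lattice B)) ∧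
      LatticeSampling.averageErrorVariance hX (LatticeSampling.lattice B) =
        LatticeSampling.processVariance (LatticeSampling.flatSpectrum (E := E) S₀ ω₀) *
          (volume.real (Metric.closedBall (0 : E) ω₀ \
              LatticeSampling.voronoiCell (LatticeSampling.lattice A)) /
            volume.real (Metric.closedBall (0 : E) ω₀)) := by
  obtain ⟨a, hab⟩ := exists_dual_basis B
  -- `A` matters only through the lattice it generates, so the dual basis `a` can replace it.
  have hAa : lattice A = Submodule.span ℤ (Set.range a) := by
    apply SetLike.coe_injective
    rw [hA, ← scaledDual_span hab]
    rfl
  set Δ := Metric.closedBall (0 : E) ω₀ with hΔ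
  have hball : volume Δ ≠ ⊤ := Metric.isBounded_closedBall.measure_lt_top.ne
  have hball0 : volume.real Δ ≠ 0 :=
    (ENNReal.toReal_pos (Metric.measure_closedBall_pos volume _ hω₀).ne' hball).ne'
  have hΔm : MeasurableSet Δ := Metric.isClosed_closedBall.measurableSet
  obtain ⟨F, hF⟩ := exists_coversShifts a (Metric.isBounded_closedBall (x := (0 : E)) (r := ω₀))
  have hV : IsAddFundamentalDomain (Submodule.span ℤ (Set.range B)) (voronoiCell (lattice B))
    (volume : Measure E) := isAddFundamentalDomain_voronoiCell B
  have hVfin : volume (voronoiCell (lattice B)) ≠ ⊤ := volume_voronoiCell_ne_top B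
  have hV0 : volume.real (voronoiCell (lattice B)) ≠ 0 :=
    (ENNReal.toReal_pos (volume_voronoiCell_ne_zero B) hVfin).ne'
  have hDfin : volume (ZSpan.fundamentalDomain a) ≠ ⊤ :=
    (ZSpan.fundamentalDomain_isBounded a).measure_lt_top.ne
  have herr : errorVarianceAt hX (lattice B) = _ :=
    funext fun t => errorVarianceAt_flatSpectrum hab hS₀ hX hS hF t
  have hJ := (integrable_foldSum_ratio (F := F) hΔm hVfin hDfin).integral_prod_left
  have hconst : IntegrableOn (fun _ : E => volume.real Δ) (voronoiCell (lattice B)) :=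
    integrableOn_const hVfin
  have hvar : processVariance (flatSpectrum (E := E) S₀ ω₀) =
      ((2 * Real.pi) ^ Module.finrank ℝ E)⁻¹ * S₀ * volume.real Δ := by
    rw [processVariance, flatSpectrum, integral_indicator hΔm, setIntegral_const, smul_eq_mul]
    ring
  have hsdiff : volume.real (Δ \ voronoiCell (Submodule.span ℤ (Set.range a))) =
      volume.real Δ - volume.real (Δ ∩ voronoiCell (Submodule.span ℤ (Set.range a))) :=
    eq_sub_of_add_eq (measureReal_sdiff_add_inter (isClosed_voronoiCell _).measurableSet hball)
  constructor
  · rw [herr]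
    exact (hconst.sub hJ).const_mul _
  -- The average is c(vol Δ - vol(Δ ∩ Ω(A))), and σ² = c · vol Δ.
  · rw [averageErrorVariance, herr, setAverage_eq, integral_const_mul, integral_sub hconst hJ,
      setIntegral_setIntegral_foldSum_ratio hab hV hVfin hF hΔm, setIntegral_const,
      measureReal_def volume (_ ∩ _), volume_covered_inter_fundamentalDomain, hvar, hAa,
      ← measureReal_def, ← hΔ, hsdiff]
    simp only [smul_eq_mul]
    field_simp
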